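/- Let $d\in\{2,3\}$, let $\Omega\subset\mathbb R^d$ be a bounded domain (nonempty, open, connected), and let $\epsilon>0$. Let $J:\mathbb R\to[0,\infty)$ be a bounded measurable function that vanishes outside $[0,1]$ and is positive on $(0,\delta)$ for some $\delta>0$; let $\omega_d$ be the volume of the unit ball of $\mathbb R^d$ and $H_\epsilon(x)$ the ball of radius $\epsilon$ centered at $x$. Let $r^e<0<r^c$ and let $g:\mathbb R\to\mathbb R$ be three times differentiable with $g,g',g'',g'''$ bounded, $g(0)=0$, $g(r)>0$ for $r\neq 0$, $g$ convex on $[r^e,r^c]$ with $g''>0$ on $(r^e,r^c)$, $g$ concave on $(-\infty,r^e]$ and on $[r^c,\infty)$, with finite limits at $\pm\infty$, and $|g''(r)|\le g''(0)$ for all $r$. For a field $u$ on $\Omega$ with values in $\mathbb R^d$ put $e_{y-x}=\frac{y-x}{|y-x|}$, $S(y,x,u)=\frac{u(y)-u(x)}{|y-x|}\cdot e_{y-x}$. Let $\mathcal V$ be the space of all $u\in L^\infty(\Omega;\mathbb R^d)$ with $\int_\Omega u\cdot w\,dx=0$ for every $w(x)=Qx+c$ with $Q^T=-Q\in\mathbb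 R^{d\times d}$, $c\in\mathbb R^d$, with the $L^\infty$ norm. A field $u\in\mathcal V$ is in the strength domain if $\sqrt{|y-x|}\,S(y,x,u)\in(r^e,r^c)$ for a.e. $x\in\Omega$ and a.e. $y\in\Omega\cap H_\epsilon(x)$, and strictly inside it if these values lie in a fixed closed interval $[a,b]\subset(r^e,r^c)$. For $b_0\in\mathcal V$ let $$E[u]=\int_\Omega\int_{H_\epsilon(x)\cap\Omega}|y-x|\,\frac{J(|y-x|/\epsilon)}{\epsilon^{d+1}\omega_d|y-x|}\,g\big(\sqrt{|y-x|}\,S(y,x,u)\big)\,dy\,dx-\int_\Omega u\cdot b_0\,dx ,$$ $$\mathcal L[u](x)=-\int_{H_\epsilon(x)\cap\Omega}\frac{2J(|y-x|/\epsilon)}{\epsilon^{d+1}\omega_d\sqrt{|y-x|}}\,g'\big(\sqrt{|y-x|}\,S(y,x,u)\big)\,e_{y-x}\,dy .$$ A critical point of $E$ is a $u\in\mathcal V$ at which the Fréchet derivative $DE[u]$ of $E:\mathcal V\to\mathbb R$ exists and is zero. Assume that $u_0\in\mathcal V$ lies strictly inside the strength domain and is a critical point of $E$. Then a field $u\in\mathcal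 V$ is a critical point of $E$ if and only if $\mathcal L[u]=b_0$ a.e. in $\Omega$, and there is $R>0$ such that, among all $u\in\mathcal V$ in the strength domain with $\|u-u_0\|_\infty\le R$, the field $u_0$ is the unique critical point of $E$ and the unique minimizer of $E$; in particular $E[u]\ge E[u_0]$ for all such $u$. -/

import Mathlib

open MeasureTheory Set Filter Topology
open scoped ENNReal

noncomputable section

namespace Peridynamics

/-- The Euclidean space `ℝ^d`. -/
abbrev Vec (d : ℕ) : Type := EuclideanSpace ℝ (Fin d)

variable {d : ℕ}

/-- Assumptions on the influence function `J`: nonnegative, bounded, supported in `[0,1]`, and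
nondegenerate, in that it does not vanish at small positive distances. -/
structure IsInfluenceFunction (J : ℝ → ℝ) : Prop where
  measurable : Measurable J
  nonneg : ∀ r, 0 ≤ J r
  bounded : ∃ M, ∀ r, J r ≤ M
  support : ∀ r, r ∉ Icc (0 : ℝ) 1 → J r = 0
  pos : ∃ δ > 0, ∀ r ∈ Ioo (0 : ℝ) δ, 0 < J r

/-- Assumptions on the cohesive potential `g`, with `(re, rc)` its interval of convexity. -/
structure IsCohesivePotential (g : ℝ → ℝ) (re rc : ℝ) : Prop where
  re_neg : re < 0
  rc_pos : 0 < rc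
  differentiable : ∀ k < 3, Differentiable ℝ (iteratedDeriv k g)
  bounded : ∀ k ≤ 3, ∃ M, ∀ r, |iteratedDeriv k g r| ≤ M
  zero : g 0 = 0
  pos : ∀ r, r ≠ 0 → 0 < g r
  convex : ConvexOn ℝ (Icc re rc) g
  concave_left : ConcaveOn ℝ (Iic re) g
  concave_right : ConcaveOn ℝ (Ici rc) g
  second_deriv_pos : ∀ r ∈ Ioo re rc, 0 < iteratedDeriv 2 g r
  second_deriv_max : ∀ r, |iteratedDeriv 2 g r| ≤ iteratedDeriv 2 g 0
  tendsto_atBot : ∃ C, Tendsto g atBot (𝓝 C)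
  tendsto_atTop : ∃ C, Tendsto g atTop (𝓝 C)

/-- The unit vector `e_{y-x}`. -/
def unitVec (y x : Vec d) : Vec d := ‖y - x‖⁻¹ • (y - x)

/-- The nonlocal strain `S(y,x,u)`. -/
def strain (y x : Vec d) (u : Vec d → Vec d) : ℝ :=
  inner ℝ (‖y - x‖⁻¹ • (u y - u x)) (unitVec y x)

/-- The scaled strain `√|y-x| S(y,x,u)`. -/
def scaledStrain (y x : Vec d) (u : Vec d → Vec d) : ℝ :=
  √‖y - x‖ * strain y x u

/-- The volume of the unit ball of `ℝ^d`. -/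
def unitBallVolume (d : ℕ) : ℝ := (volume (Metric.ball (0 : Vec d) 1)).toReal

/-- The pairwise potential `𝒲(S(y,x,u))`. -/
def pairPotential (ε : ℝ) (J g : ℝ → ℝ) (y x : Vec d) (u : Vec d → Vec d) : ℝ :=
  J (‖y - x‖ / ε) / (ε ^ (d + 1) * unitBallVolume d * ‖y - x‖) * g (scaledStrain y x u)

/-- The peridynamic potential energy `PD[u]`. -/
def potentialEnergy (Ω : Set (Vec d)) (ε : ℝ) (J g : ℝ → ℝ) (u : Vec d → Vec d) : ℝ :=
  ∫ x in Ω, ∫ y in Metric.ball x ε ∩ Ω, ‖y - x‖ * pairPotential ε J g y x u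

/-- The total energy `E[u] = PD[u] - ∫ u · b`. -/
def totalEnergy (Ω : Set (Vec d)) (ε : ℝ) (J g : ℝ → ℝ) (b u : Vec d → Vec d) : ℝ :=
  potentialEnergy Ω ε J g u - ∫ x in Ω, inner ℝ (u x) (b x)

/-- The peridynamic force operator `ℒ[u]`. -/
def forceOp (Ω : Set (Vec d)) (ε : ℝ) (J g : ℝ → ℝ) (u : Vec d → Vec d) (x : Vec d) : Vec d :=
  -∫ y in Metric.ball x ε ∩ Ω,
    (2 * (J (‖y - x‖ / ε) / (ε ^ (d + 1) * unitBallVolume d * √‖y - x‖))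
      * deriv g (scaledStrain y x u)) • unitVec y x

/-- `u` belongs to the strength domain: the scaled strain of almost every interacting pair
lies in `(re, rc)`. -/
def InStrengthDomain (Ω : Set (Vec d)) (ε re rc : ℝ) (u : Vec d → Vec d) : Prop :=
  ∀ᵐ x ∂(volume.restrict Ω), ∀ᵐ y ∂(volume.restrict (Metric.ball x ε ∩ Ω)),
    scaledStrain y x u ∈ Ioo re rc

/-- `u` lies strictly inside the strength domain: the scaled strains lie in a fixed closed
interval contained in `(re, rc)`. -/
def StrictlyInStrengthDomain (Ω : Set (Vec d)) (ε re rc : ℝ) (u : Vec d → Vec d) : Prop :=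
  ∃ a b : ℝ, re < a ∧ a ≤ b ∧ b < rc ∧
    ∀ᵐ x ∂(volume.restrict Ω), ∀ᵐ y ∂(volume.restrict (Metric.ball x ε ∩ Ω)),
      scaledStrain y x u ∈ Icc a b

/-- The infinitesimal rigid motions `x ↦ Q x + c` with `Q` skew-symmetric. -/
def rigidMotions (d : ℕ) : Set (Vec d → Vec d) :=
  {w | ∃ (Q : Matrix (Fin d) (Fin d) ℝ) (c : Vec d), Q.transpose = -Q ∧
    w = fun x => Matrix.toEuclideanLin Q x + c}

/-- `L^∞(Ω; ℝ^d)`. -/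
abbrev LInfty (Ω : Set (Vec d)) : Type := Lp (Vec d) ∞ (volume.restrict Ω)

/-- The space `𝒱` of fields in `L^∞(Ω; ℝ^d)` orthogonal to the rigid motions. For bounded `Ω`
the integrability clause holds automatically. -/
def dispSpace (Ω : Set (Vec d)) : Submodule ℝ (LInfty Ω) where
  carrier := {u | ∀ w ∈ rigidMotions d,
    Integrable (fun x => inner ℝ (u x) (w x)) (volume.restrict Ω) ∧
      ∫ x in Ω, inner ℝ (u x) (w x) = 0}
  zero_mem' := by
    intro w _
    have h : (fun x => inner ℝ ((0 : LInfty Ω) x) (w x)) =ᵐ[volume.restrict Ω]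
        fun _ => (0 : ℝ) := by
      filter_upwards [Lp.coeFn_zero (Vec d) ∞ (volume.restrict Ω)] with x hx
      rw [hx]
      simp
    exact ⟨(integrable_congr h).2 (integrable_zero _ _ _), by rw [integral_congr_ae h]; simp⟩
  add_mem' := by
    intro u v hu hv w hw
    have h : (fun x => inner ℝ ((u + v : LInfty Ω) x) (w x)) =ᵐ[volume.restrict Ω]
        fun x => inner ℝ (u x) (w x) + inner ℝ (v x) (w x) := by
      filter_upwards [Lp.coeFn_add u v] with x hx
      rw [hx, Pi.add_apply, inner_add_left]
    refine ⟨(integrable_congr h).2 ((hu w hw).1.add (hv w hw).1), ?_⟩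
    rw [integral_congr_ae h, integral_add (hu w hw).1 (hv w hw).1, (hu w hw).2, (hv w hw).2,
      add_zero]
  smul_mem' := by
    intro c u hu w hw
    have h : (fun x => inner ℝ ((c • u : LInfty Ω) x) (w x)) =ᵐ[volume.restrict Ω]
        fun x => c * inner ℝ (u x) (w x) := by
      filter_upwards [Lp.coeFn_smul c u] with x hx
      rw [hx, Pi.smul_apply, real_inner_smul_left]
    refine ⟨(integrable_congr h).2 ((hu w hw).1.const_mul c), ?_⟩
    rw [integral_congr_ae h, integral_const_mul, (hu w hw).2, mul_zero]

/-- The total energy with load `b` as a functional on `𝒱`. -/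
def energy {Ω : Set (Vec d)} (ε : ℝ) (J g : ℝ → ℝ) (b u : dispSpace Ω) : ℝ :=
  totalEnergy Ω ε J g (b : LInfty Ω) (u : LInfty Ω)

/-- `u` is a critical point of the energy with load `b`: the Fréchet derivative of the energy on
`𝒱` (with the `L^∞` norm) exists and vanishes at `u`. -/
def IsCriticalPoint {Ω : Set (Vec d)} (ε : ℝ) (J g : ℝ → ℝ) (b u : dispSpace Ω) : Prop :=
  HasFDerivAt (fun v : dispSpace Ω => energy ε J g b v) (0 : dispSpace Ω →L[ℝ] ℝ) u

end Peridynamics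

end

/-!
Write `ν` for the measure that weights the bonds `(x, y)` by the influence function. Antisymmetry
of the bond forces gives
`E[v] - E[u] = ∫ (ℒ[u] - b) · (v - u) dx + ∫ (Taylor remainder of g from s(u) to s(v)) dν`,
where `s` is the scaled strain. Since `|s(h)| ≤ 2 ‖h‖ |y - x|^(-1/2)` with an integrable kernel, the
second integral is `o(‖v - u‖)`, so the first one is the derivative of `E`. Rigid motions have no
strain, hence `ℒ[u] - b` itself belongs to `𝒱`, and testing with it yields the Euler–Lagrange
equation.

At a critical point only the Taylor remainder is left. It is nonnegative in the strength domain,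
where `g` is strictly convex, and vanishes only if `w = v - u` has no strain on almost every short
bond. Subtracting `⟪y - p, w y - w p⟫ = 0` and `⟪y - q, w y - w q⟫ = 0` then shows that the
component of `w` along `p - q` is affine in `y`. Such differences span the space, so `w` is locally
affine, and by connectedness an infinitesimal rigid motion; being orthogonal to itself, it is zero.
-/

noncomputable section

namespace Peridynamics

open scoped NNReal

variable {d : ℕ}

section TaylorRemainder

/-- The remainder of the first order Taylor expansion of `g` at `a`, evaluated at `b`. It carries
both the differentiability of the energy and its convexity on the strength domain. -/
def taylorRemainder (g : ℝ → ℝ) (a b : ℝ) : ℝ := g b - g a - deriv g a * (b - a)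

variable {g : ℝ → ℝ} {M : ℝ≥0} {s : Set ℝ} {a b : ℝ}

theorem taylorRemainder_pos (hg : StrictConvexOn ℝ s g) (hga : DifferentiableAt ℝ g a)
    (ha : a ∈ s) (hb : b ∈ s) (hab : a ≠ b) : 0 < taylorRemainder g a b := by
  unfold taylorRemainder
  rcases hab.lt_or_gt with h | h
  · have := hg.deriv_lt_slope ha hb h hga
    rw [slope_def_field, lt_div_iff₀ (sub_pos.2 h)] at this
    linarith
  · have := hg.slope_lt_deriv hb ha h hga
    rw [slope_def_field, div_lt_iff₀ (sub_pos.2 h)] at this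
    linarith

theorem taylorRemainder_nonneg (hg : ConvexOn ℝ s g) (hga : DifferentiableAt ℝ g a)
    (ha : a ∈ s) (hb : b ∈ s) : 0 ≤ taylorRemainder g a b := by
  unfold taylorRemainder
  rcases lt_trichotomy a b with h | rfl | h
  · have := hg.deriv_le_slope ha hb h hga
    rw [slope_def_field, le_div_iff₀ (sub_pos.2 h)] at this
    linarith
  · simp
  · have := hg.slope_le_deriv hb ha h hga
    rw [slope_def_field, div_le_iff₀ (sub_pos.2 h)] at this
    linarith

theorem abs_taylorRemainder_le (hg : LipschitzWith M g) (a b : ℝ) :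
    |taylorRemainder g a b| ≤ 2 * M * |b - a| := by
  have h_deriv : |deriv g a * (b - a)| ≤ M * |b - a| := by
    rw [abs_mul]
    gcongr
    exact norm_deriv_le_of_lipschitz hg
  calc |taylorRemainder g a b| ≤ |g b - g a| + |deriv g a * (b - a)| := abs_sub _ _
    _ ≤ M * |b - a| + M * |b - a| := add_le_add (hg.norm_sub_le b a) h_deriv
    _ = 2 * M * |b - a| := by ring

theorem taylorRemainder_isLittleO (hg : DifferentiableAt ℝ g a) :
    (fun t => taylorRemainder g a (a + t)) =o[𝓝 0] fun t => t := by
  refine (hasDerivAt_iff_isLittleO_nhds_zero.1 hg.hasDerivAt).congr_left fun t => ?_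
  simp only [taylorRemainder, add_sub_cancel_left, smul_eq_mul, mul_comm]

variable {X V : Type*} [MeasurableSpace X] {ν : Measure X} [NormedAddCommGroup V]

theorem aestronglyMeasurable_taylorRemainder (hg : Continuous g) {f₁ f₂ : X → ℝ}
    (hf₁ : AEStronglyMeasurable f₁ ν) (hf₂ : AEStronglyMeasurable f₂ ν) :
    AEStronglyMeasurable (fun p => taylorRemainder g (f₁ p) (f₂ p)) ν :=
  ((hg.comp_aestronglyMeasurable hf₂).sub (hg.comp_aestronglyMeasurable hf₁)).sub
    (((measurable_deriv g).comp_aemeasurable hf₁.aemeasurable).aestronglyMeasurable.mul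
      (hf₂.sub hf₁))

-- The exceptional null set in `hTk` depends on `h`, so dominated convergence is applied along
-- sequences, for which only countably many null sets matter.
theorem integral_taylorRemainder_isLittleO (hg : LipschitzWith M g) (hg' : Differentiable ℝ g)
    {a k : X → ℝ} {T : V → X → ℝ} (ha : AEStronglyMeasurable a ν)
    (hT : ∀ h, AEStronglyMeasurable (T h) ν) (hTk : ∀ h, ∀ᵐ p ∂ν, |T h p| ≤ ‖h‖ * k p)
    (hk : Integrable k ν) :
    (fun h => ∫ p, taylorRemainder g (a p) (a p + T h p) ∂ν) =o[𝓝 0] fun h : V => ‖h‖ := by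
  have h_zero : ∀ h : V, ‖h‖ = 0 → ∫ p, taylorRemainder g (a p) (a p + T h p) ∂ν = 0 := by
    intro h hh
    refine integral_eq_zero_of_ae ?_
    filter_upwards [hTk h] with p hp
    have : T h p = 0 := by simpa [hh] using hp
    simp [this, taylorRemainder]
  rw [Asymptotics.isLittleO_iff_tendsto h_zero]
  refine tendsto_of_seq_tendsto fun h hh => ?_
  simp only [Function.comp_def, ← integral_div]
  rw [← integral_zero X ℝ (μ := ν)]
  refine tendsto_integral_of_dominated_convergence (fun p => 2 * M * ‖k p‖)
    (fun n => ((aestronglyMeasurable_taylorRemainder hg'.continuous ha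
      (ha.add (hT (h n)))).mul_const _)) (hk.norm.const_mul _) (fun n => ?_) ?_
  · filter_upwards [hTk (h n)] with p hp
    rw [norm_div, norm_norm]
    refine div_le_of_le_mul₀ (norm_nonneg _) (by positivity) ?_
    calc ‖taylorRemainder g (a p) (a p + T (h n) p)‖ ≤ 2 * M * |T (h n) p| := by
          simpa using abs_taylorRemainder_le hg (a p) (a p + T (h n) p)
      _ ≤ 2 * M * (‖h n‖ * k p) := by gcongr
      _ ≤ 2 * M * (‖h n‖ * ‖k p‖) := by gcongr; exact le_abs_self _
      _ = 2 * M * ‖k p‖ * ‖h n‖ := by ring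
  · filter_upwards [ae_all_iff.2 fun n => hTk (h n)] with p hp
    have hT_bigO : (fun n => T (h n) p) =O[atTop] fun n => ‖h n‖ :=
      .of_bound (k p) (Eventually.of_forall fun n => by simpa [mul_comm] using hp n)
    have hT_tendsto : Tendsto (fun n => T (h n) p) atTop (𝓝 0) :=
      hT_bigO.trans_tendsto (tendsto_norm_zero.comp hh)
    exact (((taylorRemainder_isLittleO (hg' (a p))).comp_tendsto hT_tendsto).trans_isBigO
      hT_bigO).tendsto_div_nhds_zero

end TaylorRemainder

section RieszKernel

variable {E : Type*} [NormedAddCommGroup E] [NormedSpace ℝ E] [FiniteDimensional ℝ E]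
  [Nontrivial E] [MeasurableSpace E] [BorelSpace E] {μ : Measure E} [μ.IsAddHaarMeasure]
  {s : ℝ} {Ω : Set E}

theorem integrableOn_norm_rpow_neg_ball (hs : s < Module.finrank ℝ E) :
    IntegrableOn (fun z : E => ‖z‖ ^ (-s)) (Metric.ball 0 1) μ := by
  rw [integrableOn_fun_norm_addHaar μ (f := fun r : ℝ => r ^ (-s))]
  have h_rpow : IntegrableOn (fun r : ℝ => r ^ (Module.finrank ℝ E - 1 - s)) (Ioo 0 1) :=
    (intervalIntegral.integrableOn_Ioo_rpow_iff one_pos).2 (by linarith)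
  refine h_rpow.congr_fun (fun r hr => ?_) measurableSet_Ioo
  have h_finrank : ((Module.finrank ℝ E - 1 : ℕ) : ℝ) = Module.finrank ℝ E - 1 := by
    rw [Nat.cast_sub Module.finrank_pos, Nat.cast_one]
  simp only [smul_eq_mul]
  rw [sub_eq_add_neg, Real.rpow_add hr.1, ← h_finrank, Real.rpow_natCast]

theorem exists_setIntegral_norm_sub_rpow_neg_le (hs₀ : 0 ≤ s) (hs : s < Module.finrank ℝ E)
    [IsFiniteMeasure (μ.restrict Ω)] :
    ∃ C : ℝ, ∀ x : E, IntegrableOn (fun y => ‖y - x‖ ^ (-s)) Ω μ ∧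
      ∫ y in Ω, ‖y - x‖ ^ (-s) ∂μ ≤ C := by
  set φ : E → ℝ := (Metric.ball (0 : E) 1).indicator fun z => ‖z‖ ^ (-s) with hφ
  have hφ_int : Integrable φ μ :=
    (integrable_indicator_iff measurableSet_ball).2 (integrableOn_norm_rpow_neg_ball hs)
  have h_le : ∀ z : E, ‖z‖ ^ (-s) ≤ φ z + 1 := by
    intro z
    by_cases hz : z ∈ Metric.ball (0 : E) 1
    · simp [hφ, hz]
    · rw [hφ, indicator_of_notMem hz, zero_add]
      exact Real.rpow_le_one_of_one_le_of_nonpos (by simpa using hz) (by linarith)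
  have hφ_nonneg : ∀ z, 0 ≤ φ z := indicator_nonneg fun z _ => by positivity
  refine ⟨∫ z, φ z ∂μ + ∫ _ in Ω, 1 ∂μ, fun x => ?_⟩
  have hφ_sub : Integrable (fun y => φ (y - x)) μ := hφ_int.comp_sub_right x
  have h_bound : IntegrableOn (fun y => φ (y - x) + 1) Ω μ :=
    hφ_sub.integrableOn.add (integrable_const 1)
  have h_int : IntegrableOn (fun y => ‖y - x‖ ^ (-s)) Ω μ :=
    h_bound.mono' (Measurable.aestronglyMeasurable (by fun_prop)) (Eventually.of_forall fun y => by
      rw [Real.norm_of_nonneg (by positivity)]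
      exact h_le _)
  refine ⟨h_int, ?_⟩
  calc ∫ y in Ω, ‖y - x‖ ^ (-s) ∂μ ≤ ∫ y in Ω, (φ (y - x) + 1) ∂μ :=
        integral_mono h_int h_bound fun y => h_le _
    _ = ∫ y in Ω, φ (y - x) ∂μ + ∫ _ in Ω, 1 ∂μ :=
        integral_add hφ_sub.integrableOn (integrable_const 1)
    _ ≤ ∫ y, φ (y - x) ∂μ + ∫ _ in Ω, 1 ∂μ := by
        rw [add_le_add_iff_right]
        exact setIntegral_le_integral hφ_sub (Eventually.of_forall fun y => hφ_nonneg _)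
    _ = ∫ z, φ z ∂μ + ∫ _ in Ω, 1 ∂μ := by rw [integral_sub_right_eq_self φ x]

theorem integrable_norm_sub_rpow_neg_prod (hs₀ : 0 ≤ s) (hs : s < Module.finrank ℝ E)
    [IsFiniteMeasure (μ.restrict Ω)] :
    Integrable (fun p : E × E => ‖p.2 - p.1‖ ^ (-s)) ((μ.restrict Ω).prod (μ.restrict Ω)) := by
  obtain ⟨C, hC⟩ := exists_setIntegral_norm_sub_rpow_neg_le (μ := μ) (Ω := Ω) hs₀ hs
  have h_meas : Measurable fun p : E × E => ‖p.2 - p.1‖ ^ (-s) := by fun_prop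
  refine (integrable_prod_iff h_meas.aestronglyMeasurable).2
    ⟨Eventually.of_forall fun x => (hC x).1, ?_⟩
  have h_meas_norm := h_meas.stronglyMeasurable.norm.integral_prod_right' (ν := μ.restrict Ω)
  refine Integrable.of_bound h_meas_norm.aestronglyMeasurable C (Eventually.of_forall fun x => ?_)
  have h_norm : ∀ y, ‖‖y - x‖ ^ (-s)‖ = ‖y - x‖ ^ (-s) := fun y =>
    Real.norm_of_nonneg (by positivity)
  simp only [h_norm]
  rw [Real.norm_of_nonneg (integral_nonneg fun y => by positivity)]
  exact (hC x).2

end RieszKernel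

section SkewPairing

variable {X E : Type*} [MeasurableSpace X] {μ : Measure X}
  [NormedAddCommGroup E] [InnerProductSpace ℝ E]

theorem integrable_inner_of_memLp_top {F w : X → E} (hF : Integrable F μ) (hw : MemLp w ∞ μ) :
    Integrable (fun x => inner ℝ (F x) (w x)) μ :=
  memLp_one_iff_integrable.1
    ((innerSL ℝ).memLp_of_bilin 1 (memLp_one_iff_integrable.2 hF) hw)

theorem integral_inner_sub_of_swap_eq_neg [IsFiniteMeasure μ] [CompleteSpace E]
    {F : X × X → E} {w : X → E} (hF : Integrable F (μ.prod μ)) (hF_swap : ∀ p, F p.swap = -F p)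
    (hw : MemLp w ∞ μ) :
    ∫ p, inner ℝ (F p) (w p.2 - w p.1) ∂(μ.prod μ) =
      -2 * ∫ x, inner ℝ (∫ y, F (x, y) ∂μ) (w x) ∂μ := by
  have h_fst := integrable_inner_of_memLp_top hF (hw.comp_fst μ)
  have h_snd := integrable_inner_of_memLp_top hF (hw.comp_snd μ)
  have h_swap : ∫ p, inner ℝ (F p) (w p.2) ∂(μ.prod μ) =
      -∫ p, inner ℝ (F p) (w p.1) ∂(μ.prod μ) := by
    rw [← integral_prod_swap]
    simp only [hF_swap, Prod.snd_swap, inner_neg_left, integral_neg]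
  have h_fubini : ∫ p, inner ℝ (F p) (w p.1) ∂(μ.prod μ) =
      ∫ x, inner ℝ (∫ y, F (x, y) ∂μ) (w x) ∂μ := by
    rw [integral_prod _ h_fst]
    refine integral_congr_ae ?_
    filter_upwards [hF.prod_right_ae] with x hx
    simp only [real_inner_comm (w x)]
    exact integral_inner hx (w x)
  simp only [inner_sub_right]
  rw [integral_sub h_snd h_fst, h_swap, h_fubini]
  ring

end SkewPairing

section Strain

variable {u v w : Vec d → Vec d} {x y : Vec d}

theorem norm_unitVec_le (y x : Vec d) : ‖unitVec y x‖ ≤ 1 := by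
  rw [unitVec, norm_smul, norm_inv, norm_norm]
  exact inv_mul_le_one

theorem unitVec_comm (y x : Vec d) : unitVec x y = -unitVec y x := by
  rw [unitVec, unitVec, norm_sub_rev, ← smul_neg, neg_sub]

theorem measurable_unitVec : Measurable fun p : Vec d × Vec d => unitVec p.2 p.1 := by
  unfold unitVec
  fun_prop

theorem scaledStrain_eq (y x : Vec d) (u : Vec d → Vec d) :
    scaledStrain y x u = (√‖y - x‖)⁻¹ * inner ℝ (unitVec y x) (u y - u x) := by
  rw [scaledStrain, strain, real_inner_smul_left, real_inner_comm, ← mul_assoc,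
    ← div_eq_mul_inv, Real.sqrt_div_self', one_div]

theorem scaledStrain_comm (y x : Vec d) (u : Vec d → Vec d) :
    scaledStrain x y u = scaledStrain y x u := by
  rw [scaledStrain_eq, scaledStrain_eq, unitVec_comm, norm_sub_rev, inner_neg_left,
    ← inner_neg_right, neg_sub]

theorem scaledStrain_congr (hx : v x = u x) (hy : v y = u y) :
    scaledStrain y x v = scaledStrain y x u := by
  rw [scaledStrain_eq, scaledStrain_eq, hx, hy]

theorem scaledStrain_sub (y x : Vec d) (v u : Vec d → Vec d) :
    scaledStrain y x (v - u) = scaledStrain y x v - scaledStrain y x u := by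
  simp only [scaledStrain_eq, Pi.sub_apply]
  rw [← mul_sub, ← inner_sub_right, sub_sub_sub_comm]

theorem scaledStrain_add (y x : Vec d) (u v : Vec d → Vec d) :
    scaledStrain y x (u + v) = scaledStrain y x u + scaledStrain y x v := by
  simp only [scaledStrain_eq, Pi.add_apply]
  rw [← mul_add, ← inner_add_right, add_sub_add_comm]

theorem abs_scaledStrain_le (y x : Vec d) (u : Vec d → Vec d) :
    |scaledStrain y x u| ≤ ‖u y - u x‖ * (√‖y - x‖)⁻¹ := by
  rw [scaledStrain_eq, abs_mul, abs_of_nonneg (by positivity), mul_comm]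
  gcongr
  calc |inner ℝ (unitVec y x) (u y - u x)| ≤ ‖unitVec y x‖ * ‖u y - u x‖ :=
        abs_real_inner_le_norm _ _
    _ ≤ 1 * ‖u y - u x‖ := by gcongr; exact norm_unitVec_le y x
    _ = ‖u y - u x‖ := one_mul _

theorem inner_sub_sub_eq_zero_of_scaledStrain_eq_zero (h : scaledStrain y x w = 0) :
    inner ℝ (y - x) (w y - w x) = 0 := by
  rcases eq_or_ne y x with rfl | hyx
  · simp
  · have : ‖y - x‖ ≠ 0 := by simpa [sub_eq_zero] using hyx
    simpa [scaledStrain_eq, unitVec, real_inner_smul_left, this] using h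

variable {μ : Measure (Vec d)}

theorem aestronglyMeasurable_scaledStrain (hu : AEStronglyMeasurable u μ) :
    AEStronglyMeasurable (fun p : Vec d × Vec d => scaledStrain p.2 p.1 u) (μ.prod μ) := by
  simp only [scaledStrain_eq]
  have h_unit := measurable_unitVec (d := d)
  exact (Measurable.aestronglyMeasurable (by fun_prop)).mul
    (h_unit.aestronglyMeasurable.inner (hu.comp_snd.sub hu.comp_fst))

theorem ae_prod_abs_scaledStrain_le {C : ℝ} (hu : ∀ᵐ x ∂μ, ‖u x‖ ≤ C) :
    ∀ᵐ p ∂(μ.prod μ), |scaledStrain p.2 p.1 u| ≤ C * (2 * (√‖p.2 - p.1‖)⁻¹) := by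
  filter_upwards [Measure.quasiMeasurePreserving_fst.ae hu,
    Measure.quasiMeasurePreserving_snd.ae hu] with p hp₁ hp₂
  calc |scaledStrain p.2 p.1 u| ≤ ‖u p.2 - u p.1‖ * (√‖p.2 - p.1‖)⁻¹ :=
        abs_scaledStrain_le _ _ _
    _ ≤ (C + C) * (√‖p.2 - p.1‖)⁻¹ := by
        gcongr
        exact (norm_sub_le _ _).trans (add_le_add hp₂ hp₁)
    _ = C * (2 * (√‖p.2 - p.1‖)⁻¹) := by ring

end Strain

section InvSqrtKernel

theorem inv_sqrt_eq_rpow {r : ℝ} (hr : 0 ≤ r) : (√r)⁻¹ = r ^ (-(1 / 2) : ℝ) := by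
  rw [Real.sqrt_eq_rpow, Real.rpow_neg hr]

theorem half_lt_finrank (hd : 0 < d) : (1 / 2 : ℝ) < Module.finrank ℝ (Vec d) := by
  have : (1 : ℝ) ≤ d := by exact_mod_cast hd
  rw [finrank_euclideanSpace_fin]
  linarith

variable {Ω : Set (Vec d)} [IsFiniteMeasure (volume.restrict Ω)]

theorem exists_setIntegral_inv_sqrt_norm_sub_le (hd : 0 < d) :
    ∃ C : ℝ, ∀ x : Vec d, IntegrableOn (fun y => (√‖y - x‖)⁻¹) Ω ∧
      ∫ y in Ω, (√‖y - x‖)⁻¹ ≤ C := by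
  have : NeZero d := ⟨hd.ne'⟩
  simp only [fun y x : Vec d => inv_sqrt_eq_rpow (norm_nonneg (y - x))]
  exact exists_setIntegral_norm_sub_rpow_neg_le (by norm_num) (half_lt_finrank hd)

theorem integrable_inv_sqrt_norm_sub_prod (hd : 0 < d) :
    Integrable (fun p : Vec d × Vec d => (√‖p.2 - p.1‖)⁻¹)
      ((volume.restrict Ω).prod (volume.restrict Ω)) := by
  have : NeZero d := ⟨hd.ne'⟩
  simp only [fun y x : Vec d => inv_sqrt_eq_rpow (norm_nonneg (y - x))]
  exact integrable_norm_sub_rpow_neg_prod (by norm_num) (half_lt_finrank hd)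

end InvSqrtKernel

section Bonds

/-- The weight of the bond vector `z` in the energy, without the factor that cancels against the
one in `pairPotential`. The value at `z = 0` is `0`, as for the integrand of `potentialEnergy`. -/
def bondWeight (ε : ℝ) (J : ℝ → ℝ) : Vec d → ℝ :=
  (Metric.ball 0 ε \ {0}).indicator fun z => J (‖z‖ / ε) / (ε ^ (d + 1) * unitBallVolume d)

/-- The measure on pairs of points of `Ω` that weights each bond by its contribution to the
energy. -/
def bondMeasure (Ω : Set (Vec d)) (ε : ℝ) (J : ℝ → ℝ) : Measure (Vec d × Vec d) :=
  ((volume.restrict Ω).prod (volume.restrict Ω)).withDensity fun p =>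
    ENNReal.ofReal (bondWeight ε J (p.2 - p.1))

variable {ε : ℝ} {J : ℝ → ℝ} {Ω : Set (Vec d)}

theorem unitBallVolume_pos (d : ℕ) : 0 < unitBallVolume d :=
  ENNReal.toReal_pos (Metric.measure_ball_pos volume _ one_pos).ne' measure_ball_lt_top.ne

theorem bondWeight_sub_of_mem_ball {x y : Vec d} (hyx : y ≠ x) (hy : y ∈ Metric.ball x ε) :
    bondWeight ε J (y - x) = J (‖y - x‖ / ε) / (ε ^ (d + 1) * unitBallVolume d) :=
  indicator_of_mem (by simpa [sub_eq_zero, hyx, dist_eq_norm] using hy) _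

theorem bondWeight_sub_of_notMem_ball {x y : Vec d} (hy : y ∉ Metric.ball x ε) :
    bondWeight ε J (y - x) = 0 :=
  indicator_of_notMem (fun h => hy (by simpa [dist_eq_norm] using h.1)) _

theorem bondWeight_neg (ε : ℝ) (J : ℝ → ℝ) (z : Vec d) :
    bondWeight ε J (-z) = bondWeight ε J z := by
  simp [bondWeight, indicator]

theorem measurable_bondWeight (hJ : IsInfluenceFunction J) :
    Measurable (bondWeight ε J : Vec d → ℝ) := by
  have := hJ.measurable
  exact Measurable.indicator (by fun_prop) (measurableSet_ball.diff (measurableSet_singleton 0))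

theorem bondWeight_nonneg (hε : 0 < ε) (hJ : IsInfluenceFunction J) (z : Vec d) :
    0 ≤ bondWeight ε J z := by
  refine indicator_nonneg (fun z _ => ?_) z
  have := hJ.nonneg (‖z‖ / ε)
  have := unitBallVolume_pos d
  positivity

theorem exists_bondWeight_le (hε : 0 < ε) (hJ : IsInfluenceFunction J) :
    ∃ B, 0 ≤ B ∧ ∀ z : Vec d, bondWeight ε J z ≤ B := by
  obtain ⟨M, hM⟩ := hJ.bounded
  have hM₀ : 0 ≤ M := (hJ.nonneg 0).trans (hM 0)
  have hω := unitBallVolume_pos d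
  refine ⟨M / (ε ^ (d + 1) * unitBallVolume d), by positivity, fun z =>
    indicator_apply_le' (fun _ => ?_) fun _ => by positivity⟩
  gcongr
  exact hM _

theorem exists_bondWeight_pos (hε : 0 < ε) (hJ : IsInfluenceFunction J) :
    ∃ η > 0, ∀ z : Vec d, z ≠ 0 → ‖z‖ < η → 0 < bondWeight ε J z := by
  obtain ⟨δ, hδ, hJ_pos⟩ := hJ.pos
  refine ⟨min ε (ε * δ), by positivity, fun z hz hzη => ?_⟩
  have hzε : ‖z‖ < ε := hzη.trans_le (min_le_left _ _)
  have hzδ : ‖z‖ / ε < δ := by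
    rw [div_lt_iff₀' hε]
    exact hzη.trans_le (min_le_right _ _)
  have hJz : 0 < J (‖z‖ / ε) := hJ_pos _ ⟨by positivity, hzδ⟩
  have hω := unitBallVolume_pos d
  rw [bondWeight, indicator_of_mem (by simpa using ⟨hzε, hz⟩)]
  positivity

theorem setIntegral_ball_inter {E : Type*} [NormedAddCommGroup E] [NormedSpace ℝ E]
    (f : Vec d → E) (x : Vec d) :
    ∫ y in Metric.ball x ε ∩ Ω, f y = ∫ y in Ω, (Metric.ball x ε).indicator f y := by
  rw [integral_indicator measurableSet_ball, Measure.restrict_restrict measurableSet_ball]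

theorem ae_bondMeasure_iff (hJ : IsInfluenceFunction J) {P : Vec d × Vec d → Prop} :
    (∀ᵐ p ∂bondMeasure Ω ε J, P p) ↔
      ∀ᵐ p ∂(volume.restrict Ω).prod (volume.restrict Ω), 0 < bondWeight ε J (p.2 - p.1) → P p := by
  have := measurable_bondWeight (d := d) (ε := ε) hJ
  rw [bondMeasure, ae_withDensity_iff (by fun_prop)]
  simp only [ne_eq, ENNReal.ofReal_eq_zero, not_le]

theorem integral_bondMeasure (hε : 0 < ε) (hJ : IsInfluenceFunction J) (f : Vec d × Vec d → ℝ) :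
    ∫ p, f p ∂bondMeasure Ω ε J =
      ∫ p, bondWeight ε J (p.2 - p.1) * f p ∂(volume.restrict Ω).prod (volume.restrict Ω) := by
  have := measurable_bondWeight (d := d) (ε := ε) hJ
  rw [bondMeasure, integral_withDensity_eq_integral_toReal_smul (by fun_prop) (by simp)]
  simp only [ENNReal.toReal_ofReal (bondWeight_nonneg hε hJ _), smul_eq_mul]

theorem bondMeasure_absolutelyContinuous :
    bondMeasure Ω ε J ≪ (volume.restrict Ω).prod (volume.restrict Ω) :=
  withDensity_absolutelyContinuous _ _

theorem integrable_bondWeight_mul (hε : 0 < ε) (hJ : IsInfluenceFunction J)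
    {μ : Measure (Vec d × Vec d)} {f : Vec d × Vec d → ℝ} (hf : Integrable f μ) :
    Integrable (fun p => bondWeight ε J (p.2 - p.1) * f p) μ := by
  obtain ⟨B, -, hB⟩ := exists_bondWeight_le (d := d) hε hJ
  have := measurable_bondWeight (d := d) (ε := ε) hJ
  refine hf.bdd_mul (c := B) (Measurable.aestronglyMeasurable (by fun_prop))
    (Eventually.of_forall fun p => ?_)
  rw [Real.norm_of_nonneg (bondWeight_nonneg hε hJ _)]
  exact hB _

theorem integrable_bondMeasure (hε : 0 < ε) (hJ : IsInfluenceFunction J) {f : Vec d × Vec d → ℝ}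
    (hf : Integrable f ((volume.restrict Ω).prod (volume.restrict Ω))) :
    Integrable f (bondMeasure Ω ε J) := by
  have := measurable_bondWeight (d := d) (ε := ε) hJ
  rw [bondMeasure, integrable_withDensity_iff_integrable_smul' (by fun_prop) (by simp)]
  simp only [ENNReal.toReal_ofReal (bondWeight_nonneg hε hJ _), smul_eq_mul]
  exact integrable_bondWeight_mul hε hJ hf

end Bonds

section Energy

/-- The force that `p.2` exerts on `p.1` in the configuration `u`, up to a factor `2`. -/
def bondForce (ε : ℝ) (J g : ℝ → ℝ) (u : Vec d → Vec d) (p : Vec d × Vec d) : Vec d :=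
  (bondWeight ε J (p.2 - p.1) * deriv g (scaledStrain p.2 p.1 u) * (√‖p.2 - p.1‖)⁻¹) •
    unitVec p.2 p.1

variable {Ω : Set (Vec d)} {ε : ℝ} {J g : ℝ → ℝ} {M : ℝ≥0}
  {u v w : Vec d → Vec d}

theorem bondForce_swap (ε : ℝ) (J g : ℝ → ℝ) (u : Vec d → Vec d) (p : Vec d × Vec d) :
    bondForce ε J g u p.swap = -bondForce ε J g u p := by
  rw [bondForce, bondForce, Prod.fst_swap, Prod.snd_swap, scaledStrain_comm, unitVec_comm,
    norm_sub_rev, ← neg_sub p.2 p.1, bondWeight_neg, smul_neg]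

theorem inner_bondForce (ε : ℝ) (J g : ℝ → ℝ) (u w : Vec d → Vec d) (p : Vec d × Vec d) :
    inner ℝ (bondForce ε J g u p) (w p.2 - w p.1) = bondWeight ε J (p.2 - p.1) *
      (deriv g (scaledStrain p.2 p.1 u) * scaledStrain p.2 p.1 w) := by
  rw [bondForce, real_inner_smul_left, scaledStrain_eq p.2 p.1 w]
  ring

theorem aestronglyMeasurable_bondForce (hJ : IsInfluenceFunction J) (g : ℝ → ℝ)
    {μ : Measure (Vec d)} (hu : AEStronglyMeasurable u μ) :
    AEStronglyMeasurable (bondForce ε J g u) (μ.prod μ) := by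
  have h_weight := measurable_bondWeight (d := d) (ε := ε) hJ
  have h_deriv := (measurable_deriv g).comp_aemeasurable
    (aestronglyMeasurable_scaledStrain hu).aemeasurable
  have h_unit := measurable_unitVec (d := d)
  refine (AEMeasurable.mul (AEMeasurable.mul ?_ h_deriv) ?_).aestronglyMeasurable.smul
    h_unit.aestronglyMeasurable <;> exact Measurable.aemeasurable (by fun_prop)

theorem exists_norm_bondForce_le (hε : 0 < ε) (hJ : IsInfluenceFunction J)
    (hg : LipschitzWith M g) :
    ∃ B, 0 ≤ B ∧ ∀ (u : Vec d → Vec d) (p : Vec d × Vec d),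
      ‖bondForce ε J g u p‖ ≤ B * (√‖p.2 - p.1‖)⁻¹ := by
  obtain ⟨B, hB₀, hB⟩ := exists_bondWeight_le (d := d) hε hJ
  refine ⟨B * M, by positivity, fun u p => ?_⟩
  have h_deriv : ‖deriv g (scaledStrain p.2 p.1 u)‖ ≤ M := norm_deriv_le_of_lipschitz hg
  have h_weight : ‖bondWeight ε J (p.2 - p.1)‖ ≤ B := by
    rw [Real.norm_of_nonneg (bondWeight_nonneg hε hJ _)]
    exact hB _
  calc ‖bondForce ε J g u p‖ = ‖bondWeight ε J (p.2 - p.1)‖ *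
        ‖deriv g (scaledStrain p.2 p.1 u)‖ * (√‖p.2 - p.1‖)⁻¹ * ‖unitVec p.2 p.1‖ := by
        rw [bondForce, norm_smul, norm_mul, norm_mul,
          Real.norm_of_nonneg (r := (√‖p.2 - p.1‖)⁻¹) (by positivity)]
    _ ≤ B * M * (√‖p.2 - p.1‖)⁻¹ * 1 := by
        gcongr
        exact norm_unitVec_le _ _
    _ = B * M * (√‖p.2 - p.1‖)⁻¹ := mul_one _

theorem forceOp_eq (Ω : Set (Vec d)) (ε : ℝ) (J g : ℝ → ℝ) (u : Vec d → Vec d) (x : Vec d) :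
    forceOp Ω ε J g u x = (-2 : ℝ) • ∫ y in Ω, bondForce ε J g u (x, y) := by
  rw [forceOp, setIntegral_ball_inter, ← integral_neg, ← integral_smul]
  congr 1 with y : 1
  rcases eq_or_ne y x with rfl | hyx
  · simp [bondForce, unitVec, indicator]
  by_cases hy : y ∈ Metric.ball x ε
  · rw [bondForce, bondWeight_sub_of_mem_ball hyx hy, indicator_of_mem hy, smul_smul, ← neg_smul]
    congr 1
    field_simp
  · simp [bondForce, bondWeight_sub_of_notMem_ball hy, indicator_of_notMem hy]

theorem indicator_ball_pairPotential (x y : Vec d) :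
    (Metric.ball x ε).indicator (fun y => ‖y - x‖ * pairPotential ε J g y x u) y =
      bondWeight ε J (y - x) * g (scaledStrain y x u) := by
  rcases eq_or_ne y x with rfl | hyx
  · simp [bondWeight, indicator]
  by_cases hy : y ∈ Metric.ball x ε
  · have : ‖y - x‖ ≠ 0 := by simpa [sub_eq_zero] using hyx
    rw [bondWeight_sub_of_mem_ball hyx hy, indicator_of_mem hy, pairPotential]
    field_simp
  · rw [bondWeight_sub_of_notMem_ball hy, indicator_of_notMem hy, zero_mul]

variable [IsFiniteMeasure (volume.restrict Ω)]

theorem integrable_bondForce (hd : 0 < d) (hε : 0 < ε) (hJ : IsInfluenceFunction J)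
    (hg : LipschitzWith M g) (hu : AEStronglyMeasurable u (volume.restrict Ω)) :
    Integrable (bondForce ε J g u) ((volume.restrict Ω).prod (volume.restrict Ω)) := by
  obtain ⟨B, -, hB⟩ := exists_norm_bondForce_le (d := d) hε hJ hg
  exact ((integrable_inv_sqrt_norm_sub_prod hd).const_mul B).mono'
    (aestronglyMeasurable_bondForce hJ g hu) (Eventually.of_forall (hB u))

theorem memLp_forceOp (hd : 0 < d) (hε : 0 < ε) (hJ : IsInfluenceFunction J)
    (hg : LipschitzWith M g) (hu : AEStronglyMeasurable u (volume.restrict Ω)) :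
    MemLp (forceOp Ω ε J g u) ∞ (volume.restrict Ω) := by
  obtain ⟨B, hB₀, hB⟩ := exists_norm_bondForce_le (d := d) hε hJ hg
  obtain ⟨C, hC⟩ := exists_setIntegral_inv_sqrt_norm_sub_le (Ω := Ω) hd
  have h_meas : AEStronglyMeasurable (forceOp Ω ε J g u) (volume.restrict Ω) := by
    rw [funext (forceOp_eq Ω ε J g u)]
    exact (aestronglyMeasurable_bondForce hJ g hu).integral_prod_right'.const_smul (-2 : ℝ)
  refine memLp_top_of_bound h_meas (2 * (B * C)) (Eventually.of_forall fun x => ?_)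
  have h_int : IntegrableOn (fun y => B * (√‖y - x‖)⁻¹) Ω := (hC x).1.const_mul B
  calc ‖forceOp Ω ε J g u x‖ = 2 * ‖∫ y in Ω, bondForce ε J g u (x, y)‖ := by
        rw [forceOp_eq, norm_smul, norm_neg, Real.norm_two]
    _ ≤ 2 * ∫ y in Ω, B * (√‖y - x‖)⁻¹ := by
        gcongr
        exact norm_integral_le_of_norm_le h_int (Eventually.of_forall fun y => hB u (x, y))
    _ ≤ 2 * (B * C) := by
        rw [integral_const_mul]
        gcongr
        exact (hC x).2

theorem integral_deriv_mul_scaledStrain (hd : 0 < d) (hε : 0 < ε) (hJ : IsInfluenceFunction J)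
    (hg : LipschitzWith M g) (hu : AEStronglyMeasurable u (volume.restrict Ω))
    (hw : MemLp w ∞ (volume.restrict Ω)) :
    ∫ p, deriv g (scaledStrain p.2 p.1 u) * scaledStrain p.2 p.1 w ∂bondMeasure Ω ε J =
      ∫ x in Ω, inner ℝ (forceOp Ω ε J g u x) (w x) := by
  rw [integral_bondMeasure hε hJ]
  simp only [← inner_bondForce, forceOp_eq, real_inner_smul_left, integral_const_mul]
  exact integral_inner_sub_of_swap_eq_neg (integrable_bondForce hd hε hJ hg hu)
    (bondForce_swap ε J g u) hw

theorem integrable_scaledStrain (hd : 0 < d) (hu : MemLp u ∞ (volume.restrict Ω)) :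
    Integrable (fun p : Vec d × Vec d => scaledStrain p.2 p.1 u)
      ((volume.restrict Ω).prod (volume.restrict Ω)) :=
  (((integrable_inv_sqrt_norm_sub_prod hd).const_mul 2).const_mul _).mono'
    (aestronglyMeasurable_scaledStrain hu.1)
    (ae_prod_abs_scaledStrain_le (ae_le_lpNorm_exponent_top hu))

theorem integrable_comp_scaledStrain (hd : 0 < d) (hg : LipschitzWith M g)
    (hu : MemLp u ∞ (volume.restrict Ω)) :
    Integrable (fun p : Vec d × Vec d => g (scaledStrain p.2 p.1 u))
      ((volume.restrict Ω).prod (volume.restrict Ω)) := by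
  refine ((integrable_const ‖g 0‖).add ((integrable_scaledStrain hd hu).norm.const_mul M)).mono'
    (hg.continuous.comp_aestronglyMeasurable (aestronglyMeasurable_scaledStrain hu.1))
    (Eventually.of_forall fun p => ?_)
  have h := hg.norm_sub_le (scaledStrain p.2 p.1 u) 0
  rw [sub_zero] at h
  calc ‖g (scaledStrain p.2 p.1 u)‖ ≤ ‖g 0‖ + ‖g (scaledStrain p.2 p.1 u) - g 0‖ :=
        norm_le_norm_add_norm_sub' _ _
    _ ≤ ‖g 0‖ + M * ‖scaledStrain p.2 p.1 u‖ := by gcongr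

theorem potentialEnergy_eq (hd : 0 < d) (hε : 0 < ε) (hJ : IsInfluenceFunction J)
    (hg : LipschitzWith M g) (hu : MemLp u ∞ (volume.restrict Ω)) :
    potentialEnergy Ω ε J g u = ∫ p, g (scaledStrain p.2 p.1 u) ∂bondMeasure Ω ε J := by
  rw [potentialEnergy, integral_bondMeasure hε hJ,
    integral_prod _ (integrable_bondWeight_mul hε hJ (integrable_comp_scaledStrain hd hg hu))]
  simp only [setIntegral_ball_inter, indicator_ball_pairPotential]

theorem integrable_deriv_mul_scaledStrain (hd : 0 < d) (hg : LipschitzWith M g)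
    (hu : AEStronglyMeasurable u (volume.restrict Ω)) (hw : MemLp w ∞ (volume.restrict Ω)) :
    Integrable (fun p : Vec d × Vec d =>
        deriv g (scaledStrain p.2 p.1 u) * scaledStrain p.2 p.1 w)
      ((volume.restrict Ω).prod (volume.restrict Ω)) :=
  (integrable_scaledStrain hd hw).bdd_mul (c := M)
    ((measurable_deriv g).comp_aemeasurable
      (aestronglyMeasurable_scaledStrain hu).aemeasurable).aestronglyMeasurable
    (Eventually.of_forall fun _ => norm_deriv_le_of_lipschitz hg)

theorem integrable_taylorRemainder (hd : 0 < d) (hg : LipschitzWith M g)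
    (hu : MemLp u ∞ (volume.restrict Ω)) (hv : MemLp v ∞ (volume.restrict Ω)) :
    Integrable (fun p : Vec d × Vec d =>
        taylorRemainder g (scaledStrain p.2 p.1 u) (scaledStrain p.2 p.1 v))
      ((volume.restrict Ω).prod (volume.restrict Ω)) := by
  simp only [taylorRemainder, ← scaledStrain_sub]
  exact ((integrable_comp_scaledStrain hd hg hv).sub (integrable_comp_scaledStrain hd hg hu)).sub
    (integrable_deriv_mul_scaledStrain hd hg hu.1 (hv.sub hu))

theorem potentialEnergy_sub (hd : 0 < d) (hε : 0 < ε) (hJ : IsInfluenceFunction J)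
    (hg : LipschitzWith M g) (hu : MemLp u ∞ (volume.restrict Ω))
    (hv : MemLp v ∞ (volume.restrict Ω)) :
    potentialEnergy Ω ε J g v - potentialEnergy Ω ε J g u =
      (∫ x in Ω, inner ℝ (forceOp Ω ε J g u x) ((v - u) x)) +
        ∫ p, taylorRemainder g (scaledStrain p.2 p.1 u) (scaledStrain p.2 p.1 v)
          ∂bondMeasure Ω ε J := by
  have hgu := integrable_bondMeasure hε hJ (integrable_comp_scaledStrain hd hg hu)
  have hgv := integrable_bondMeasure hε hJ (integrable_comp_scaledStrain hd hg hv)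
  have h_deriv := integrable_bondMeasure hε hJ
    (integrable_deriv_mul_scaledStrain hd hg hu.1 (hv.sub hu))
  rw [potentialEnergy_eq hd hε hJ hg hu, potentialEnergy_eq hd hε hJ hg hv,
    ← integral_deriv_mul_scaledStrain hd hε hJ hg hu.1 (hv.sub hu)]
  simp only [taylorRemainder, ← scaledStrain_sub]
  have h_diff : Integrable (fun p : Vec d × Vec d =>
      g (scaledStrain p.2 p.1 v) - g (scaledStrain p.2 p.1 u)) (bondMeasure Ω ε J) := hgv.sub hgu
  rw [integral_sub h_diff h_deriv, integral_sub hgv hgu]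
  ring

end Energy

section Rigidity

theorem ae_restrict_neBot_of_isOpen {X : Type*} [TopologicalSpace X] [MeasurableSpace X]
    {μ : Measure X} [μ.IsOpenPosMeasure] {U : Set X} (hU : IsOpen U) (hne : U.Nonempty) :
    (ae (μ.restrict U)).NeBot := by
  rw [ae_neBot, Ne, Measure.restrict_eq_zero]
  exact (hU.measure_pos μ hne).ne'

variable {E F : Type*} [NormedAddCommGroup E] [InnerProductSpace ℝ E] [MeasurableSpace E]
  [NormedAddCommGroup F] [NormedSpace ℝ F]

/-- The directions along which the component of `w` is almost everywhere affine. They make up the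
whole space exactly when `w` itself is almost everywhere affine. -/
def affineDirections (w : E → E) (μ : Measure E) : Submodule ℝ E where
  carrier := {v | ∃ l : E →ᵃ[ℝ] ℝ, ∀ᵐ y ∂μ, inner ℝ v (w y) = l y}
  zero_mem' := ⟨0, by simp⟩
  add_mem' := by
    rintro v v' ⟨l, hl⟩ ⟨l', hl'⟩
    refine ⟨l + l', ?_⟩
    filter_upwards [hl, hl'] with y hy hy'
    rw [inner_add_left, hy, hy', AffineMap.coe_add, Pi.add_apply]
  smul_mem' := by
    rintro a v ⟨l, hl⟩
    refine ⟨a • l, ?_⟩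
    filter_upwards [hl] with y hy
    rw [real_inner_smul_left, hy, AffineMap.coe_smul, Pi.smul_apply, smul_eq_mul]

variable {w : E → E} {μ : Measure E}

theorem sub_mem_affineDirections {p q : E} (hp : ∀ᵐ y ∂μ, inner ℝ (y - p) (w y - w p) = 0)
    (hq : ∀ᵐ y ∂μ, inner ℝ (y - q) (w y - w q) = 0) : p - q ∈ affineDirections w μ := by
  refine ⟨(innerₛₗ ℝ (w q - w p)).toAffineMap +
    AffineMap.const ℝ E (inner ℝ p (w p) - inner ℝ q (w q)), ?_⟩
  filter_upwards [hp, hq] with y hyp hyq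
  simp only [inner_sub_left, inner_sub_right, AffineMap.coe_add, Pi.add_apply,
    LinearMap.coe_toAffineMap, innerₛₗ_apply_apply, AffineMap.const_apply] at hyp hyq ⊢
  rw [real_inner_comm y (w p), real_inner_comm y (w q)]
  linarith

variable [FiniteDimensional ℝ E]

theorem exists_ae_eq_affineMap_of_affineDirections_eq_top (h : affineDirections w μ = ⊤) :
    ∃ T : E →ᵃ[ℝ] E, w =ᵐ[μ] T := by
  let b := stdOrthonormalBasis ℝ E
  have h_basis : ∀ i, b i ∈ affineDirections w μ := fun i => h ▸ Submodule.mem_top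
  choose l hl using h_basis
  refine ⟨(Fintype.linearCombination ℝ b).toAffineMap.comp (AffineMap.pi l), ?_⟩
  filter_upwards [ae_all_iff.2 hl] with y hy
  rw [← b.sum_repr' (w y)]
  simp [Fintype.linearCombination_apply, hy]

theorem affineMap_eq_of_ae_eq [OpensMeasurableSpace E] [μ.IsOpenPosMeasure] {S T : E →ᵃ[ℝ] F}
    {U : Set E} (hU : IsOpen U) (hne : U.Nonempty) (h : S =ᵐ[μ.restrict U] T) : S = T :=
  AffineMap.ext_on (hU.affineSpan_eq_top hne)
    (Measure.eqOn_open_of_ae_eq h hU S.continuous_of_finiteDimensional.continuousOn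
      T.continuous_of_finiteDimensional.continuousOn)

theorem exists_ae_eq_affineMap_of_locally [OpensMeasurableSpace E] [μ.IsOpenPosMeasure]
    {w : E → F} {Ω : Set E} (hΩ : IsOpen Ω) (hconn : IsConnected Ω)
    (h : ∀ x ∈ Ω, ∃ U, IsOpen U ∧ x ∈ U ∧ ∃ T : E →ᵃ[ℝ] F, w =ᵐ[μ.restrict U] T) :
    ∃ T : E →ᵃ[ℝ] F, w =ᵐ[μ.restrict Ω] T := by
  choose! U hU hxU T hT using h
  have h_const : ∀ x ∈ Ω, ∀ y ∈ Ω, T x = T y := by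
    intro x hx y hy
    refine hconn.isPreconnected.induction₂ (fun x y => T x = T y) (fun x hx => ?_)
      (fun _ _ _ _ _ _ => Eq.trans) (fun _ _ _ _ => Eq.symm) hx hy
    filter_upwards [mem_nhdsWithin_of_mem_nhds ((hU x hx).mem_nhds (hxU x hx)),
      self_mem_nhdsWithin] with y hyx hy
    refine affineMap_eq_of_ae_eq (μ := μ) ((hU x hx).inter (hU y hy)) ⟨y, hyx, hxU y hy⟩ ?_
    filter_upwards [ae_restrict_of_ae_restrict_of_subset inter_subset_left (hT x hx),
      ae_restrict_of_ae_restrict_of_subset inter_subset_right (hT y hy)] with z hzx hzy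
    rw [← hzx, hzy]
  obtain ⟨x₀, hx₀⟩ := hconn.nonempty
  refine ⟨T x₀, ?_⟩
  rw [EventuallyEq, ae_iff, Measure.restrict_apply_eq_zero' hΩ.measurableSet]
  refine measure_null_of_locally_null _ fun x hx => ⟨{y | ¬w y = T x₀ y} ∩ U x, ?_, ?_⟩
  · exact inter_mem (mem_of_superset self_mem_nhdsWithin inter_subset_left)
      (mem_nhdsWithin_of_mem_nhds ((hU x hx.2).mem_nhds (hxU x hx.2)))
  · rw [h_const x₀ hx₀ x hx.2, ← Measure.restrict_apply_eq_zero' (hU x hx.2).measurableSet]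
    exact hT x hx.2

variable [BorelSpace E] [μ.IsAddHaarMeasure]

theorem affineDirections_eq_top {U : Set E} (hU : IsOpen U) (hne : U.Nonempty)
    (h : ∀ᵐ x ∂μ.restrict U, ∀ᵐ y ∂μ.restrict U, inner ℝ (y - x) (w y - w x) = 0) :
    affineDirections w (μ.restrict U) = ⊤ := by
  have := ae_restrict_neBot_of_isOpen (μ := μ) hU hne
  obtain ⟨q, hq⟩ := h.exists
  set P := AffineSubspace.mk' q (affineDirections w (μ.restrict U)) with hP_def
  -- Otherwise almost every point of `U` lies in the proper affine subspace `P`, a null set.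
  by_contra h_ne
  have hP : P ≠ ⊤ := fun h_top => h_ne <| by
    rw [← AffineSubspace.direction_mk' q (affineDirections w (μ.restrict U)), ← hP_def, h_top,
      AffineSubspace.direction_top]
  have h_mem : ∀ᵐ x ∂μ.restrict U, x ∈ P := h.mono fun p hp =>
    AffineSubspace.mem_mk'.2 (sub_mem_affineDirections hp hq)
  have h_notMem : ∀ᵐ x ∂μ.restrict U, x ∉ P :=
    ae_restrict_of_ae (measure_eq_zero_iff_ae_notMem.1 (Measure.addHaar_affineSubspace μ P hP))
  obtain ⟨x, hx, hx'⟩ := (h_mem.and h_notMem).exists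
  exact hx' hx

theorem inner_linear_self_eq_zero {T : E →ᵃ[ℝ] E} {U : Set E} (hU : IsOpen U)
    (hne : U.Nonempty) (hw : w =ᵐ[μ.restrict U] T)
    (h : ∀ᵐ x ∂μ.restrict U, ∀ᵐ y ∂μ.restrict U, inner ℝ (y - x) (w y - w x) = 0) (z : E) :
    inner ℝ z (T.linear z) = 0 := by
  have := ae_restrict_neBot_of_isOpen (μ := μ) hU hne
  obtain ⟨x, ⟨hx, hwx⟩, hxU⟩ := ((h.and hw).and (ae_restrict_mem hU.measurableSet)).exists
  have h_zero : EqOn (fun y => inner ℝ (y - x) (T y - T x)) 0 U := by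
    refine Measure.eqOn_open_of_ae_eq (μ := μ) ?_ hU ?_ continuousOn_const
    · filter_upwards [hx, hw] with y hy hwy
      rwa [hwy, hwx] at hy
    · have := T.continuous_of_finiteDimensional
      exact Continuous.continuousOn (by fun_prop)
  have h_tendsto : Tendsto (fun t : ℝ => x + t • z) (𝓝 0) (𝓝 x) :=
    Continuous.tendsto' (by fun_prop) _ _ (by simp)
  obtain ⟨t, ht, htU⟩ : ∃ t : ℝ, t ≠ 0 ∧ x + t • z ∈ U :=
    ((eventually_mem_nhdsWithin (s := {(0 : ℝ)}ᶜ)).and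
      (tendsto_nhdsWithin_of_tendsto_nhds h_tendsto (hU.mem_nhds hxU))).exists
  have h_diff : T (x + t • z) - T x = t • T.linear z := by
    simpa using (T.linearMap_vsub (x + t • z) x).symm
  simpa [h_diff, real_inner_smul_left, real_inner_smul_right, ht] using h_zero htU

theorem exists_ae_eq_affineMap_skew {Ω : Set E} (hΩ : IsOpen Ω) (hconn : IsConnected Ω) {η : ℝ}
    (hη : 0 < η) (h : ∀ᵐ x ∂μ.restrict Ω, ∀ᵐ y ∂μ.restrict Ω,
      ‖y - x‖ < η → inner ℝ (y - x) (w y - w x) = 0) :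
    ∃ T : E →ᵃ[ℝ] E, (∀ z, inner ℝ z (T.linear z) = 0) ∧ w =ᵐ[μ.restrict Ω] T := by
  let U (x : E) : Set E := Ω ∩ Metric.ball x (η / 2)
  have hU (x : E) : IsOpen (U x) := hΩ.inter Metric.isOpen_ball
  have hxU : ∀ x ∈ Ω, x ∈ U x := fun x hx => ⟨hx, Metric.mem_ball_self (half_pos hη)⟩
  have h_local (x : E) : ∀ᵐ p ∂μ.restrict (U x), ∀ᵐ q ∂μ.restrict (U x),
      inner ℝ (q - p) (w q - w p) = 0 := by
    filter_upwards [ae_restrict_of_ae_restrict_of_subset inter_subset_left h,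
      ae_restrict_mem (hU x).measurableSet] with p hp hpU
    filter_upwards [ae_restrict_of_ae_restrict_of_subset inter_subset_left hp,
      ae_restrict_mem (hU x).measurableSet] with q hq hqU
    apply hq
    rw [← dist_eq_norm]
    linarith [dist_triangle_right q p x, Metric.mem_ball.1 hpU.2, Metric.mem_ball.1 hqU.2]
  obtain ⟨T, hT⟩ := exists_ae_eq_affineMap_of_locally hΩ hconn fun x hx =>
    ⟨U x, hU x, hxU x hx, exists_ae_eq_affineMap_of_affineDirections_eq_top
      (affineDirections_eq_top (hU x) ⟨x, hxU x hx⟩ (h_local x))⟩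
  obtain ⟨x, hx⟩ := hconn.nonempty
  exact ⟨T, inner_linear_self_eq_zero (hU x) ⟨x, hxU x hx⟩
    (ae_restrict_of_ae_restrict_of_subset inter_subset_left hT) (h_local x), hT⟩

end Rigidity

section RigidMotions

variable {Ω : Set (Vec d)}

theorem inner_toEuclideanLin_self_eq_zero {Q : Matrix (Fin d) (Fin d) ℝ}
    (hQ : Q.transpose = -Q) (z : Vec d) : inner ℝ z (Matrix.toEuclideanLin Q z) = 0 := by
  have h_adjoint : LinearMap.adjoint (Matrix.toEuclideanLin Q) = -Matrix.toEuclideanLin Q := by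
    rw [← Matrix.toEuclideanLin_conjTranspose_eq_adjoint,
      Matrix.conjTranspose_eq_transpose_of_trivial, hQ, map_neg]
  have h := LinearMap.adjoint_inner_right (Matrix.toEuclideanLin Q) z z
  rw [h_adjoint, LinearMap.neg_apply, inner_neg_right, real_inner_comm] at h
  rw [real_inner_comm]
  linarith

theorem coe_mem_rigidMotions {T : Vec d →ᵃ[ℝ] Vec d} (hT : ∀ z, inner ℝ z (T.linear z) = 0) :
    ⇑T ∈ rigidMotions d := by
  have h_adjoint : LinearMap.adjoint T.linear = -T.linear := by
    refine ((LinearMap.eq_adjoint_iff _ _).2 fun x y => ?_).symm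
    have h := hT (x + y)
    rw [map_add, inner_add_left, inner_add_right, inner_add_right, hT x, hT y] at h
    rw [LinearMap.neg_apply, inner_neg_left, real_inner_comm]
    linarith
  refine ⟨Matrix.toEuclideanLin.symm T.linear, T 0, Matrix.toEuclideanLin.injective ?_, ?_⟩
  · rw [← Matrix.conjTranspose_eq_transpose_of_trivial,
      Matrix.toEuclideanLin_conjTranspose_eq_adjoint, map_neg, LinearEquiv.apply_symm_apply,
      h_adjoint]
  · rw [LinearEquiv.apply_symm_apply]
    exact T.decomp

theorem scaledStrain_of_mem_rigidMotions {ρ : Vec d → Vec d} (hρ : ρ ∈ rigidMotions d)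
    (y x : Vec d) : scaledStrain y x ρ = 0 := by
  obtain ⟨Q, c, hQ, rfl⟩ := hρ
  rw [scaledStrain_eq, unitVec, add_sub_add_right_eq_sub, ← map_sub, real_inner_smul_left,
    inner_toEuclideanLin_self_eq_zero hQ, mul_zero, mul_zero]

theorem memLp_top_of_mem_rigidMotions (hΩ : Bornology.IsBounded Ω) {ρ : Vec d → Vec d}
    (hρ : ρ ∈ rigidMotions d) : MemLp ρ ∞ (volume.restrict Ω) := by
  obtain ⟨Q, c, -, rfl⟩ := hρ
  have h_cont : Continuous fun x => Matrix.toEuclideanLin Q x + c :=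
    (LinearMap.continuous_of_finiteDimensional _).add continuous_const
  obtain ⟨C, hC⟩ := hΩ.isCompact_closure.exists_bound_of_continuousOn h_cont.continuousOn
  refine memLp_top_of_bound h_cont.aestronglyMeasurable C ?_
  filter_upwards [ae_restrict_of_ae_restrict_of_subset subset_closure
    (ae_restrict_mem isClosed_closure.measurableSet)] with x hx using hC x hx

end RigidMotions

section EulerLagrange

theorem ae_norm_le_norm {X E : Type*} [MeasurableSpace X] {μ : Measure X} [NormedAddCommGroup E]
    (u : Lp E ∞ μ) : ∀ᵐ x ∂μ, ‖u x‖ ≤ ‖u‖ := by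
  rw [Lp.norm_def, toReal_eLpNorm (Lp.aestronglyMeasurable u)]
  exact ae_le_lpNorm_exponent_top (Lp.memLp u)

theorem ae_prod_scaledStrain_congr {μ : Measure (Vec d)} {u v : Vec d → Vec d}
    (h : v =ᵐ[μ] u) : ∀ᵐ p ∂(μ.prod μ), scaledStrain p.2 p.1 v = scaledStrain p.2 p.1 u := by
  filter_upwards [Measure.quasiMeasurePreserving_fst.ae h,
    Measure.quasiMeasurePreserving_snd.ae h] with p hp₁ hp₂ using scaledStrain_congr hp₁ hp₂

variable {Ω : Set (Vec d)} {ε : ℝ} {J g : ℝ → ℝ} {M : ℝ≥0}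

/-- The `L²` pairing with an integrable field, as a functional on `𝒱`. The derivative of the energy
is of this form. -/
def pairing (F : Vec d → Vec d) (hF : MemLp F 1 (volume.restrict Ω)) : dispSpace Ω →L[ℝ] ℝ :=
  ((innerSL ℝ).lpPairing (volume.restrict Ω) 1 ∞ (hF.toLp F)).comp (dispSpace Ω).subtypeL

theorem pairing_apply {F : Vec d → Vec d} (hF : MemLp F 1 (volume.restrict Ω))
    (w : dispSpace Ω) :
    pairing F hF w = ∫ x in Ω, inner ℝ (F x) ((w : LInfty Ω) x) := by
  refine (ContinuousLinearMap.lpPairing_eq_integral _ _ _).trans (integral_congr_ae ?_)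
  filter_upwards [hF.coeFn_toLp] with x hx
  rw [hx]
  rfl

variable [IsFiniteMeasure (volume.restrict Ω)]

theorem memLp_residual (hd : 0 < d) (hε : 0 < ε) (hJ : IsInfluenceFunction J)
    (hg : LipschitzWith M g) (b u : dispSpace Ω) :
    MemLp (fun x => forceOp Ω ε J g (u : LInfty Ω) x - (b : LInfty Ω) x) ∞
      (volume.restrict Ω) :=
  (memLp_forceOp hd hε hJ hg (Lp.aestronglyMeasurable _)).sub (Lp.memLp _)

theorem energy_sub (hd : 0 < d) (hε : 0 < ε) (hJ : IsInfluenceFunction J)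
    (hg : LipschitzWith M g) (b u v : dispSpace Ω) :
    energy ε J g b v - energy ε J g b u =
      (∫ x in Ω, inner ℝ (forceOp Ω ε J g (u : LInfty Ω) x - (b : LInfty Ω) x)
        (((v - u : dispSpace Ω) : LInfty Ω) x)) +
      ∫ p, taylorRemainder g (scaledStrain p.2 p.1 (u : LInfty Ω))
        (scaledStrain p.2 p.1 (v : LInfty Ω)) ∂bondMeasure Ω ε J := by
  have h_int {F : Vec d → Vec d} (hF : MemLp F ∞ (volume.restrict Ω)) (w : LInfty Ω) :
      Integrable (fun x => inner ℝ (F x) (w x)) (volume.restrict Ω) :=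
    integrable_inner_of_memLp_top (hF.integrable le_top) (Lp.memLp w)
  have h_force := h_int (memLp_forceOp hd hε hJ hg (Lp.aestronglyMeasurable (u : LInfty Ω)))
  have h_load := h_int (Lp.memLp (b : LInfty Ω))
  have h_potential := potentialEnergy_sub hd hε hJ hg (Lp.memLp (u : LInfty Ω)) (Lp.memLp v)
  have h_coe : ∫ x in Ω, inner ℝ (forceOp Ω ε J g (u : LInfty Ω) x)
        (((v : LInfty Ω) - (u : LInfty Ω) : Vec d → Vec d) x) =
      ∫ x in Ω, inner ℝ (forceOp Ω ε J g (u : LInfty Ω) x)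
        (((v - u : dispSpace Ω) : LInfty Ω) x) := by
    refine integral_congr_ae ?_
    filter_upwards [Lp.coeFn_sub (v : LInfty Ω) u] with x hx
    rw [Submodule.coe_sub, hx]
  have h_work : ∫ x in Ω, inner ℝ ((b : LInfty Ω) x) (((v - u : dispSpace Ω) : LInfty Ω) x) =
      (∫ x in Ω, inner ℝ ((v : LInfty Ω) x) ((b : LInfty Ω) x)) -
        ∫ x in Ω, inner ℝ ((u : LInfty Ω) x) ((b : LInfty Ω) x) := by
    simp only [real_inner_comm ((b : LInfty Ω) _)]
    rw [← integral_sub (h_load v) (h_load u)]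
    refine integral_congr_ae ?_
    filter_upwards [Lp.coeFn_sub (v : LInfty Ω) u] with x hx
    rw [Submodule.coe_sub, hx, Pi.sub_apply, inner_sub_right]
  simp only [inner_sub_left]
  rw [integral_sub (h_force _) (h_load _), h_work, ← h_coe, energy, energy, totalEnergy,
    totalEnergy]
  linarith

theorem hasFDerivAt_energy (hd : 0 < d) (hε : 0 < ε) (hJ : IsInfluenceFunction J)
    (hg : LipschitzWith M g) (hg' : Differentiable ℝ g) (b u : dispSpace Ω) :
    HasFDerivAt (fun v : dispSpace Ω => energy ε J g b v)
      (pairing _ ((memLp_residual hd hε hJ hg b u).mono_exponent le_top)) u := by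
  have h_ac := bondMeasure_absolutelyContinuous (Ω := Ω) (ε := ε) (J := J)
  have h_meas (w : LInfty Ω) : AEStronglyMeasurable
      (fun p : Vec d × Vec d => scaledStrain p.2 p.1 w) (bondMeasure Ω ε J) :=
    (aestronglyMeasurable_scaledStrain (Lp.aestronglyMeasurable w)).mono_ac h_ac
  have h_littleO := integral_taylorRemainder_isLittleO hg hg' (h_meas u)
    (fun h : dispSpace Ω => h_meas h)
    (fun h => h_ac.ae_le (ae_prod_abs_scaledStrain_le (ae_norm_le_norm (h : LInfty Ω))))
    (integrable_bondMeasure hε hJ ((integrable_inv_sqrt_norm_sub_prod hd).const_mul 2))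
  refine hasFDerivAt_iff_isLittleO_nhds_zero.2 (h_littleO.of_norm_right.congr_left fun h => ?_)
  rw [energy_sub hd hε hJ hg, pairing_apply, add_sub_cancel_left, add_sub_cancel_left]
  refine integral_congr_ae ?_
  filter_upwards [h_ac.ae_le (ae_prod_scaledStrain_congr (Lp.coeFn_add (u : LInfty Ω) h))]
    with p hp
  rw [Submodule.coe_add, hp, scaledStrain_add]

theorem isCriticalPoint_iff_forall_integral_eq_zero (hd : 0 < d) (hε : 0 < ε)
    (hJ : IsInfluenceFunction J) (hg : LipschitzWith M g) (hg' : Differentiable ℝ g)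
    {b u : dispSpace Ω} :
    IsCriticalPoint ε J g b u ↔ ∀ w : dispSpace Ω,
      ∫ x in Ω, inner ℝ (forceOp Ω ε J g (u : LInfty Ω) x - (b : LInfty Ω) x)
        ((w : LInfty Ω) x) = 0 := by
  have h_residual := (memLp_residual hd hε hJ hg b u).mono_exponent (p := 1) le_top
  have h_deriv := hasFDerivAt_energy hd hε hJ hg hg' b u
  simp only [← pairing_apply h_residual]
  refine ⟨fun h => DFunLike.congr_fun (h_deriv.unique h), fun h => ?_⟩
  have h_zero : pairing _ h_residual = 0 := ContinuousLinearMap.ext h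
  rwa [h_zero] at h_deriv

end EulerLagrange

section EulerLagrangeEquation

variable {Ω : Set (Vec d)}

theorem isFiniteMeasure_restrict_of_isBounded (hΩ : Bornology.IsBounded Ω) :
    IsFiniteMeasure (volume.restrict Ω) :=
  ⟨by simpa using hΩ.measure_lt_top⟩

theorem ae_eq_zero_of_integral_inner_self_eq_zero {X E : Type*} [MeasurableSpace X]
    {μ : Measure X} [NormedAddCommGroup E] [InnerProductSpace ℝ E] {w : X → E}
    (hw : Integrable (fun x => inner ℝ (w x) (w x)) μ) (h : ∫ x, inner ℝ (w x) (w x) ∂μ = 0) :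
    w =ᵐ[μ] 0 := by
  filter_upwards [(integral_eq_zero_iff_of_nonneg (fun _ => real_inner_self_nonneg) hw).1 h]
    with x hx using inner_self_eq_zero.1 hx

theorem exists_dispSpace_ae_eq (hΩ : Bornology.IsBounded Ω) {F : Vec d → Vec d}
    (hF : MemLp F ∞ (volume.restrict Ω))
    (h : ∀ ρ ∈ rigidMotions d, ∫ x in Ω, inner ℝ (F x) (ρ x) = 0) :
    ∃ w : dispSpace Ω, ((w : LInfty Ω) : Vec d → Vec d) =ᵐ[volume.restrict Ω] F := by
  have := isFiniteMeasure_restrict_of_isBounded hΩ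
  refine ⟨⟨hF.toLp F, fun ρ hρ => ?_⟩, hF.coeFn_toLp⟩
  have h_congr : (fun x => inner ℝ (hF.toLp F x) (ρ x)) =ᵐ[volume.restrict Ω]
      fun x => inner ℝ (F x) (ρ x) := by
    filter_upwards [hF.coeFn_toLp] with x hx
    rw [hx]
  rw [integrable_congr h_congr, integral_congr_ae h_congr]
  exact ⟨integrable_inner_of_memLp_top (hF.integrable le_top)
    (memLp_top_of_mem_rigidMotions hΩ hρ), h ρ hρ⟩

variable {ε : ℝ} {J g : ℝ → ℝ} {M : ℝ≥0}

theorem exists_dispSpace_ae_eq_forceOp (hd : 0 < d) (hΩ : Bornology.IsBounded Ω) (hε : 0 < ε)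
    (hJ : IsInfluenceFunction J) (hg : LipschitzWith M g) {u : Vec d → Vec d}
    (hu : AEStronglyMeasurable u (volume.restrict Ω)) :
    ∃ f : dispSpace Ω, ((f : LInfty Ω) : Vec d → Vec d) =ᵐ[volume.restrict Ω]
      forceOp Ω ε J g u := by
  have := isFiniteMeasure_restrict_of_isBounded hΩ
  refine exists_dispSpace_ae_eq hΩ (memLp_forceOp hd hε hJ hg hu) fun ρ hρ => ?_
  rw [← integral_deriv_mul_scaledStrain hd hε hJ hg hu (memLp_top_of_mem_rigidMotions hΩ hρ)]
  simp only [scaledStrain_of_mem_rigidMotions hρ, mul_zero, integral_zero]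

theorem isCriticalPoint_iff (hd : 0 < d) (hΩ : Bornology.IsBounded Ω) (hε : 0 < ε)
    (hJ : IsInfluenceFunction J) (hg : LipschitzWith M g) (hg' : Differentiable ℝ g)
    {b u : dispSpace Ω} :
    IsCriticalPoint ε J g b u ↔
      forceOp Ω ε J g (u : LInfty Ω) =ᵐ[volume.restrict Ω] (b : LInfty Ω) := by
  have := isFiniteMeasure_restrict_of_isBounded hΩ
  rw [isCriticalPoint_iff_forall_integral_eq_zero hd hε hJ hg hg']
  refine ⟨fun h => ?_, fun h w => integral_eq_zero_of_ae ?_⟩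
  · obtain ⟨f, hf⟩ :=
      exists_dispSpace_ae_eq_forceOp hd hΩ hε hJ hg (Lp.aestronglyMeasurable (u : LInfty Ω))
    set r : dispSpace Ω := f - b
    have hr : ((r : LInfty Ω) : Vec d → Vec d) =ᵐ[volume.restrict Ω]
        fun x => forceOp Ω ε J g (u : LInfty Ω) x - (b : LInfty Ω) x := by
      filter_upwards [hf, Lp.coeFn_sub (f : LInfty Ω) b] with x hx hx_sub
      rw [Submodule.coe_sub, hx_sub, Pi.sub_apply, hx]
    have h_test : ∫ x in Ω, inner ℝ ((r : LInfty Ω) x) ((r : LInfty Ω) x) = 0 := by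
      rw [← h r]
      refine integral_congr_ae ?_
      filter_upwards [hr] with x hx
      rw [← hx]
    have hr_zero := ae_eq_zero_of_integral_inner_self_eq_zero
      (integrable_inner_of_memLp_top ((Lp.memLp (r : LInfty Ω)).integrable le_top) (Lp.memLp _))
      h_test
    filter_upwards [hr, hr_zero] with x hx hx_zero
    exact sub_eq_zero.1 (hx.symm.trans hx_zero)
  · filter_upwards [h] with x hx
    rw [hx, sub_self, inner_zero_left, Pi.zero_apply]

end EulerLagrangeEquation

section StrengthDomain

variable {Ω : Set (Vec d)} {ε : ℝ} {J g : ℝ → ℝ} {re rc : ℝ} {M : ℝ≥0}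

theorem StrictlyInStrengthDomain.inStrengthDomain {u : Vec d → Vec d}
    (h : StrictlyInStrengthDomain Ω ε re rc u) : InStrengthDomain Ω ε re rc u := by
  obtain ⟨a, b, ha, -, hb, h⟩ := h
  filter_upwards [h] with x hx
  filter_upwards [hx] with y hy using Icc_subset_Ioo ha hb hy

theorem InStrengthDomain.ae_bondMeasure {u : LInfty Ω} (h : InStrengthDomain Ω ε re rc u)
    (hJ : IsInfluenceFunction J) :
    ∀ᵐ p ∂bondMeasure Ω ε J, scaledStrain p.2 p.1 u ∈ Ioo re rc := by
  have h_weight := measurable_bondWeight (d := d) (ε := ε) hJ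
  have h_strain : Measurable fun p : Vec d × Vec d => scaledStrain p.2 p.1 u := by
    have := (Lp.stronglyMeasurable u).measurable
    unfold scaledStrain strain unitVec
    fun_prop
  have h_meas : MeasurableSet {p : Vec d × Vec d |
      0 < bondWeight ε J (p.2 - p.1) → scaledStrain p.2 p.1 u ∈ Ioo re rc} :=
    (measurableSet_lt measurable_const (by fun_prop)).imp (h_strain measurableSet_Ioo)
  rw [ae_bondMeasure_iff hJ, Measure.ae_prod_iff_ae_ae h_meas]
  filter_upwards [h] with x hx
  rw [← Measure.restrict_restrict measurableSet_ball, ae_restrict_iff' measurableSet_ball] at hx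
  filter_upwards [hx] with y hy h_pos
  exact hy (not_imp_comm.1 bondWeight_sub_of_notMem_ball h_pos.ne')

theorem eq_zero_of_ae_eq_rigidMotion {w : dispSpace Ω} {ρ : Vec d → Vec d}
    (hρ : ρ ∈ rigidMotions d) (h : ((w : LInfty Ω) : Vec d → Vec d) =ᵐ[volume.restrict Ω] ρ) :
    w = 0 := by
  have h_self : (fun x => inner ℝ ((w : LInfty Ω) x) (ρ x)) =ᵐ[volume.restrict Ω]
      fun x => inner ℝ ((w : LInfty Ω) x) ((w : LInfty Ω) x) := by
    filter_upwards [h] with x hx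
    rw [hx]
  obtain ⟨h_int, h_zero⟩ := w.2 ρ hρ
  rw [integrable_congr h_self] at h_int
  rw [integral_congr_ae h_self] at h_zero
  exact Subtype.ext
    (Lp.eq_zero_iff_ae_eq_zero.2 (ae_eq_zero_of_integral_inner_self_eq_zero h_int h_zero))

theorem eq_of_scaledStrain_ae_eq (hΩ_open : IsOpen Ω) (hΩ_conn : IsConnected Ω) (hε : 0 < ε)
    (hJ : IsInfluenceFunction J) {u v : dispSpace Ω}
    (h : ∀ᵐ p ∂bondMeasure Ω ε J,
      scaledStrain p.2 p.1 (v : LInfty Ω) = scaledStrain p.2 p.1 (u : LInfty Ω)) : v = u := by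
  obtain ⟨η, hη, h_weight⟩ := exists_bondWeight_pos (d := d) hε hJ
  have h_inner : ∀ᵐ x ∂volume.restrict Ω, ∀ᵐ y ∂volume.restrict Ω, ‖y - x‖ < η →
      inner ℝ (y - x) (((v : LInfty Ω) - (u : LInfty Ω) : Vec d → Vec d) y -
        ((v : LInfty Ω) - (u : LInfty Ω) : Vec d → Vec d) x) = 0 := by
    filter_upwards [Measure.ae_ae_of_ae_prod ((ae_bondMeasure_iff hJ).1 h)] with x hx
    filter_upwards [hx] with y hy hyx
    refine inner_sub_sub_eq_zero_of_scaledStrain_eq_zero ?_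
    rcases eq_or_ne (y - x) 0 with h_eq | h_ne
    · rw [scaledStrain_eq, h_eq, norm_zero, Real.sqrt_zero, inv_zero, zero_mul]
    · rw [scaledStrain_sub, hy (h_weight _ h_ne hyx), sub_self]
  obtain ⟨T, hT, h_eq⟩ := exists_ae_eq_affineMap_skew hΩ_open hΩ_conn hη h_inner
  refine sub_eq_zero.1 (eq_zero_of_ae_eq_rigidMotion (coe_mem_rigidMotions hT) ?_)
  exact (Lp.coeFn_sub (v : LInfty Ω) u).trans h_eq

end StrengthDomain

section Minimizers

variable {Ω : Set (Vec d)} {ε : ℝ} {J g : ℝ → ℝ} {re rc : ℝ} {M : ℝ≥0}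

theorem IsCriticalPoint.energy_sub_eq [IsFiniteMeasure (volume.restrict Ω)] {b u : dispSpace Ω}
    (h : IsCriticalPoint ε J g b u) (hd : 0 < d) (hε : 0 < ε) (hJ : IsInfluenceFunction J)
    (hg : LipschitzWith M g) (hg' : Differentiable ℝ g) (v : dispSpace Ω) :
    energy ε J g b v - energy ε J g b u =
      ∫ p, taylorRemainder g (scaledStrain p.2 p.1 (u : LInfty Ω))
        (scaledStrain p.2 p.1 (v : LInfty Ω)) ∂bondMeasure Ω ε J := by
  rw [energy_sub hd hε hJ hg,
    (isCriticalPoint_iff_forall_integral_eq_zero hd hε hJ hg hg').1 h, zero_add]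

theorem ae_taylorRemainder_nonneg (hJ : IsInfluenceFunction J) (hg' : Differentiable ℝ g)
    (hg_convex : ConvexOn ℝ (Ioo re rc) g) {u v : LInfty Ω}
    (hu : InStrengthDomain Ω ε re rc u) (hv : InStrengthDomain Ω ε re rc v) :
    ∀ᵐ p ∂bondMeasure Ω ε J,
      0 ≤ taylorRemainder g (scaledStrain p.2 p.1 u) (scaledStrain p.2 p.1 v) := by
  filter_upwards [hu.ae_bondMeasure hJ, hv.ae_bondMeasure hJ] with p hpu hpv
  exact taylorRemainder_nonneg hg_convex (hg' _) hpu hpv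

theorem IsCriticalPoint.energy_le [IsFiniteMeasure (volume.restrict Ω)] {b u v : dispSpace Ω}
    (h : IsCriticalPoint ε J g b u) (hd : 0 < d) (hε : 0 < ε) (hJ : IsInfluenceFunction J)
    (hg : LipschitzWith M g) (hg' : Differentiable ℝ g)
    (hg_convex : ConvexOn ℝ (Ioo re rc) g)
    (hu : InStrengthDomain Ω ε re rc (u : LInfty Ω))
    (hv : InStrengthDomain Ω ε re rc (v : LInfty Ω)) :
    energy ε J g b u ≤ energy ε J g b v := by
  rw [← sub_nonneg, h.energy_sub_eq hd hε hJ hg hg']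
  exact integral_nonneg_of_ae (ae_taylorRemainder_nonneg hJ hg' hg_convex hu hv)

theorem IsCriticalPoint.eq_of_energy_le [IsFiniteMeasure (volume.restrict Ω)]
    {b u v : dispSpace Ω} (h : IsCriticalPoint ε J g b u) (hd : 0 < d) (hΩ_open : IsOpen Ω)
    (hΩ_conn : IsConnected Ω) (hε : 0 < ε) (hJ : IsInfluenceFunction J)
    (hg : LipschitzWith M g) (hg' : Differentiable ℝ g)
    (hg_convex : StrictConvexOn ℝ (Ioo re rc) g)
    (hu : InStrengthDomain Ω ε re rc (u : LInfty Ω))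
    (hv : InStrengthDomain Ω ε re rc (v : LInfty Ω))
    (h_le : energy ε J g b v ≤ energy ε J g b u) : v = u := by
  have h_nonneg := ae_taylorRemainder_nonneg hJ hg' hg_convex.convexOn hu hv
  have h_zero := (h.energy_sub_eq hd hε hJ hg hg' v).symm.trans_le (sub_nonpos.2 h_le) |>.antisymm
    (integral_nonneg_of_ae h_nonneg)
  have h_int := integrable_bondMeasure hε hJ
    (integrable_taylorRemainder hd hg (Lp.memLp (u : LInfty Ω)) (Lp.memLp v))
  refine eq_of_scaledStrain_ae_eq hΩ_open hΩ_conn hε hJ ?_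
  filter_upwards [(integral_eq_zero_iff_of_nonneg_ae h_nonneg h_int).1 h_zero,
    hu.ae_bondMeasure hJ, hv.ae_bondMeasure hJ] with p hp hpu hpv
  by_contra h_ne
  exact (taylorRemainder_pos hg_convex (hg' _) hpu hpv (Ne.symm h_ne)).ne' hp

end Minimizers

section CohesivePotential

variable {g : ℝ → ℝ} {re rc : ℝ}

theorem IsCohesivePotential.differentiable_self (hg : IsCohesivePotential g re rc) :
    Differentiable ℝ g := by
  simpa using hg.differentiable 0 (by norm_num)

theorem IsCohesivePotential.exists_lipschitzWith (hg : IsCohesivePotential g re rc) :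
    ∃ M : ℝ≥0, LipschitzWith M g := by
  obtain ⟨M, hM⟩ := hg.bounded 1 (by norm_num)
  rw [iteratedDeriv_one] at hM
  refine ⟨M.toNNReal, lipschitzWith_of_nnnorm_deriv_le hg.differentiable_self fun r => ?_⟩
  exact NNReal.coe_le_coe.1 ((hM r).trans (Real.le_coe_toNNReal M))

theorem IsCohesivePotential.strictConvexOn (hg : IsCohesivePotential g re rc) :
    StrictConvexOn ℝ (Ioo re rc) g :=
  strictConvexOn_of_deriv2_pos' (convex_Ioo re rc) hg.differentiable_self.continuous.continuousOn
    fun r hr => by simpa [iteratedDeriv_eq_iterate] using hg.second_deriv_pos r hr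

end CohesivePotential

end Peridynamics

end

open Peridynamics in
theorem theorem3p6_general {d : ℕ} (hd : 0 < d)
    {Ω : Set (Vec d)} (hΩ_open : IsOpen Ω) (hΩ_conn : IsConnected Ω)
    (hΩ_bdd : Bornology.IsBounded Ω) {ε : ℝ} (hε : 0 < ε)
    {J : ℝ → ℝ} (hJ : IsInfluenceFunction J)
    {g : ℝ → ℝ} {M : NNReal} (hg : LipschitzWith M g) (hg' : Differentiable ℝ g)
    {re rc : ℝ} (hg_convex : StrictConvexOn ℝ (Ioo re rc) g)
    (b₀ u₀ : dispSpace Ω) (hu₀ : InStrengthDomain Ω ε re rc (u₀ : LInfty Ω))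
    (hcrit : IsCriticalPoint ε J g b₀ u₀) :
    (∀ u : dispSpace Ω, IsCriticalPoint ε J g b₀ u ↔
      forceOp Ω ε J g (u : LInfty Ω) =ᵐ[volume.restrict Ω] (b₀ : LInfty Ω)) ∧
    ∀ u : dispSpace Ω, InStrengthDomain Ω ε re rc (u : LInfty Ω) →
      energy ε J g b₀ u₀ ≤ energy ε J g b₀ u ∧
      (energy ε J g b₀ u = energy ε J g b₀ u₀ → u = u₀) ∧
      (IsCriticalPoint ε J g b₀ u → u = u₀) := by
  have := isFiniteMeasure_restrict_of_isBounded hΩ_bdd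
  refine ⟨fun u => isCriticalPoint_iff hd hΩ_bdd hε hJ hg hg', fun u hu => ?_⟩
  have h_unique := hcrit.eq_of_energy_le hd hΩ_open hΩ_conn hε hJ hg hg' hg_convex hu₀ hu
  exact ⟨hcrit.energy_le hd hε hJ hg hg' hg_convex.convexOn hu₀ hu, fun h_eq => h_unique h_eq.le,
    fun h => h_unique (h.energy_le hd hε hJ hg hg' hg_convex.convexOn hu hu₀)⟩

theorem theorem3p6 {d : ℕ} (hd : d = 2 ∨ d = 3)
    {Ω : Set (Peridynamics.Vec d)} (hΩ_open : IsOpen Ω) (hΩ_conn : IsConnected Ω)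
    (hΩ_bdd : Bornology.IsBounded Ω)
    {ε : ℝ} (hε : 0 < ε)
    {J : ℝ → ℝ} (hJ : Peridynamics.IsInfluenceFunction J)
    {g : ℝ → ℝ} {re rc : ℝ} (hg : Peridynamics.IsCohesivePotential g re rc)
    (b₀ u₀ : Peridynamics.dispSpace Ω)
    (hu₀ : Peridynamics.StrictlyInStrengthDomain Ω ε re rc
      (u₀ : Peridynamics.LInfty Ω))
    (hcrit : Peridynamics.IsCriticalPoint ε J g b₀ u₀) :
    (∀ u : Peridynamics.dispSpace Ω, Peridynamics.IsCriticalPoint ε J g b₀ u ↔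
      Peridynamics.forceOp Ω ε J g (u : Peridynamics.LInfty Ω)
        =ᵐ[MeasureTheory.volume.restrict Ω] (b₀ : Peridynamics.LInfty Ω)) ∧
    ∃ R : ℝ, 0 < R ∧
      ∀ u : Peridynamics.dispSpace Ω, ‖u - u₀‖ ≤ R →
        Peridynamics.InStrengthDomain Ω ε re rc (u : Peridynamics.LInfty Ω) →
          Peridynamics.energy ε J g b₀ u₀ ≤ Peridynamics.energy ε J g b₀ u ∧
          (Peridynamics.energy ε J g b₀ u = Peridynamics.energy ε J g b₀ u₀ → u = u₀) ∧
          (Peridynamics.IsCriticalPoint ε J g b₀ u → u = u₀) := by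
  obtain ⟨M, hg_lip⟩ := hg.exists_lipschitzWith
  obtain ⟨h_iff, h_min⟩ := theorem3p6_general (by lia) hΩ_open hΩ_conn hΩ_bdd hε
    hJ hg_lip hg.differentiable_self hg.strictConvexOn b₀ u₀ hu₀.inStrengthDomain hcrit
  exact ⟨h_iff, 1, one_pos, fun u _ hu => h_min u hu⟩
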